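/- All sequences below are real sequences indexed by the positive integers, and limits of sequences are coordinatewise. For $q\ge 1$, $\gamma>0$ and a sequence $(k_l)_{l\ge1}$ put $g(z)=\sum_{l\ge1}k_lz^{l-1}\in\mathbb R[[z]]$ and let $\partial, d, d', *_g$ be the operators on $\mathbb R[[z]]$ given by $\partial z^n=nz^{n-1}$; $d(1)=0$ and $d(z^n)=z^{n-1}$ for $n\ge1$; $d'(z^n)=0$ for $n$ even and $d'(z^n)=2z^{n-1}$ for $n$ odd; $*_g f=g f$. Define $\mathrm T^{q,\gamma}_{k\to m}\big((k_l)_{l\ge 1}\big)=(m_{2j})_{j\ge1}$ by $$m_{2j}=[z^0]\Big(\partial+2\gamma d+\big((q-1)\gamma-\tfrac12\big)d'+*_g\Big)^{2j-1}g(z),\qquad j\ge 1 .$$ This map is a bijection from the set of sequences $(k_l)_{l\ge1}$ with $k_l=0$ for all odd $l$ onto the set of all real sequences $(m_{2j})_{j\ge1}$; its inverse is denoted $\mathrm T^{q,\gamma}_{m\to k}$, and $(k_l)=\mathrm T^{q,\gamma}_{m\to k}\big((m_{2j})\big)$ are the $q$-$\gamma$ cumulants of $(m_{2j})$. The $q$-$\gamma$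 convolution of two sequences of even moments is $m^a\boxplus_{q,\gamma}m^b=\mathrm T^{q,\gamma}_{k\to m}\big(\mathrm T^{q,\gamma}_{m\to k}(m^a)+\mathrm T^{q,\gamma}_{m\to k}(m^b)\big)$ (all odd moments being $0$). Similarly, the map taking a sequence $(\kappa_l)_{l\ge1}$ to the sequence $(m_n)_{n\ge 1}$ with $m_n=\sum_{\pi}\prod_{B\in\pi}\kappa_{|B|}$, where $\pi$ runs over all set partitions of $\{1,\dots,n\}$, is a bijection of $\mathbb R^{\infty}$ onto itself; its inverse $\mathrm T^0_{m\to k}$ gives the classical cumulants of a moment sequence. **Theorem.** (1) Let $(m_{2j})_{j\ge1}$ be a real sequence, let $(k_l)_{l\ge1}=\mathrm T^{q,\gamma}_{m\to k}\big((m_{2j})_{j\ge1}\big)$ and $k'_l=(q\gamma)^l\,2^{2l-1}(l-1)!\,k_{2l}$. Then $$\lim_{\gamma\to0^+,\ q\gamma\to\infty}(k'_l)_{l\ge1}=\mathrm T^0_{m\to k}\big((m_{2j})_{j\ge1}\big),$$ where on the right $m_{2j}$ is taken as the $j$-th moment. (2) Consequently, for any two real sequences $(m^a_{2j})_{j\ge1}$,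 $(m^b_{2j})_{j\ge1}$ the limit $$(m^c_{2j})_{j\ge1}=\lim_{\gamma\to0^+,\ q\gamma\to\infty}\ (m^a_{2j})_{j\ge1}\boxplus_{q,\gamma}(m^b_{2j})_{j\ge1}$$ exists and $\mathrm T^0_{m\to k}(m^c)=\mathrm T^0_{m\to k}(m^a)+\mathrm T^0_{m\to k}(m^b)$. In particular, if $\mu_a,\mu_b$ are probability measures on $\mathbb R_{\ge0}$ with all moments finite and $m^a_{2j}=\int x^j\,d\mu_a$, $m^b_{2j}=\int x^j\,d\mu_b$ for all $j\ge1$, then all moments of the usual convolution $\mu_a*\mu_b$ are finite and $m^c_{2j}=\int x^j\,d(\mu_a*\mu_b)$ for all $j\ge1$. -/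

import Mathlib

open Filter Topology

noncomputable section

/-- The power series `g(z) = ∑_{l ≥ 1} k_l z^{l-1}` of a real sequence `(k_l)_{l ≥ 1}`. -/
def cumulantSeries (k : ℕ+ → ℝ) : PowerSeries ℝ :=
  PowerSeries.mk fun n => k n.succPNat

/-- The linear operator `d` on `ℝ⟦z⟧` with `d(1) = 0` and `d(z^n) = z^(n-1)` for `n ≥ 1`. -/
def lowerOp (f : PowerSeries ℝ) : PowerSeries ℝ :=
  PowerSeries.mk fun n => PowerSeries.coeff (n + 1) f

/-- The linear operator `d'` on `ℝ⟦z⟧` with `d'(z^n) = 0` for `n` even and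
`d'(z^n) = 2 z^(n-1)` for `n` odd. -/
def oddLowerOp (f : PowerSeries ℝ) : PowerSeries ℝ :=
  PowerSeries.mk fun n => if Odd (n + 1) then 2 * PowerSeries.coeff (n + 1) f else 0

/-- The operator `∂ + 2γ d + ((q - 1)γ - 1/2) d' + *_g` on `ℝ⟦z⟧`. -/
def qgOperator (q γ : ℝ) (g f : PowerSeries ℝ) : PowerSeries ℝ :=
  PowerSeries.derivative ℝ f + (2 * γ) • lowerOp f
    + ((q - 1) * γ - 1 / 2) • oddLowerOp f + g * f

/-- The map `T_{k→m}^{q,γ}` from q-γ cumulants `(k_l)_{l ≥ 1}` to even moments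
`(m_{2j})_{j ≥ 1}`; the `j`-th entry of the output is `m_{2j}`. -/
def qgCumulantToMoment (q γ : ℝ) (k : ℕ+ → ℝ) : ℕ+ → ℝ := fun j =>
  PowerSeries.constantCoeff
    ((qgOperator q γ (cumulantSeries k))^[2 * (j : ℕ) - 1] (cumulantSeries k))

/-- The real sequences `(k_l)_{l ≥ 1}` with `k_l = 0` for all odd `l`. -/
def oddVanishing : Set (ℕ+ → ℝ) := {k | ∀ l : ℕ+, Odd (l : ℕ) → k l = 0}

/-- The map `T_{m→k}^{q,γ}`, inverse to `T_{k→m}^{q,γ}` on the sequences that vanish at the odd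
indices: it sends `(m_{2j})_{j ≥ 1}` to the sequence of its q-γ cumulants. -/
def qgMomentToCumulant (q γ : ℝ) (m : ℕ+ → ℝ) : ℕ+ → ℝ :=
  Function.invFunOn (qgCumulantToMoment q γ) oddVanishing m

/-- The q-γ convolution of two sequences of even moments: the operation on moment sequences that
adds the q-γ cumulants. -/
def qgConvolution (q γ : ℝ) (a b : ℕ+ → ℝ) : ℕ+ → ℝ :=
  qgCumulantToMoment q γ (qgMomentToCumulant q γ a + qgMomentToCumulant q γ b)

/-- The rescaled cumulants `k'_l = (qγ)^l 2^(2l-1) (l-1)! k_{2l}`. -/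
def rescaledCumulant (q γ : ℝ) (k : ℕ+ → ℝ) : ℕ+ → ℝ := fun l =>
  (q * γ) ^ (l : ℕ) * 2 ^ (2 * (l : ℕ) - 1) * (Nat.factorial ((l : ℕ) - 1) : ℝ) * k (2 * l)

/-- The classical moment-cumulant formula `m_n = ∑_π ∏_{B ∈ π} κ_{|B|}`, the sum being over all
set partitions `π` of an `n`-element set. Blocks are non-empty, so that `Nat.toPNat'` only
regards `|B|` as a positive integer. -/
def classicalCumulantToMoment (κ : ℕ+ → ℝ) : ℕ+ → ℝ := fun n =>
  ∑ π : Finpartition (Finset.univ : Finset (Fin (n : ℕ))), ∏ B ∈ π.parts, κ B.card.toPNat'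

/-- The map from moments to classical cumulants, inverse to `classicalCumulantToMoment`. -/
def classicalMomentToCumulant (m : ℕ+ → ℝ) : ℕ+ → ℝ :=
  Function.invFun classicalCumulantToMoment m

/-- The regime `γ → 0` through positive values and `qγ → +∞`, for the pair `(q, γ)`. -/
def classicalRegime : Filter (ℝ × ℝ) :=
  comap (fun p => p.2) (𝓝[>] (0 : ℝ)) ⊓ comap (fun p => p.1 * p.2) atTop

end

/-! Put `s = qγ` and `ε = 1/s`. Since the odd-indexed cumulants vanish, `g` is an odd series and the
operator exchanges even and odd series. Write even series as `A(z²/(4s))` and odd ones as `z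
B(z²/(4s))/(2s)`. In these coordinates `g` becomes `G`, the derivative of the exponential generating
function of the rescaled cumulants. Two applications of the operator become `oddStep`, `A ↦ A' + γ
dA + GA`, followed by `evenStep`, `B ↦ B + εX(B' + GB)`. So the moments are `deformedMoment γ ε` of
the rescaled cumulants (`qgCumulantToMoment_eq`).

At `γ = ε = 0` two steps reduce to `∂ + G`. If `f' = Gf` and `f(0) = 1`, then `f · (∂ + G)^n 1 = ∂^n
f`, so the constant terms are the classical moments (`deformedMoment_zero_zero`).

The deformed map is jointly continuous in `γ`, `ε` and the cumulants. It is also triangular, with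
positive diagonal entries for `γ, ε ≥ 0` (`deformedMoment_eq_add`, `leadCoeff_pos`). Hence it is
bijective, and its inverse converges as well (`tendsto_of_tendsto_deformedMoment`). Adding cumulants
and mapping forward again gives the limit of the convolution. -/

section CumulantLimit

open PowerSeries Finset
open scoped PowerSeries.WithPiTopology

/-! ### Set partitions and the classical moment recursion -/

/-- The sum over the set partitions of `s` of the products of the cumulants of the blocks. -/
noncomputable def partitionSum {α : Type} [DecidableEq α] (κ : ℕ+ → ℝ) (s : Finset α) : ℝ :=
  ∑ π : Finpartition s, ∏ B ∈ π.parts, κ B.card.toPNat'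

lemma partitionSum_empty {α : Type} [DecidableEq α] (κ : ℕ+ → ℝ) :
    partitionSum κ (∅ : Finset α) = 1 := by
  have h : ∀ π : Finpartition (∅ : Finset α), π = Finpartition.empty (Finset α) := fun π =>
    Subsingleton.elim (α := Finpartition (⊥ : Finset α)) _ _
  exact (Fintype.sum_eq_single (α := Finpartition (∅ : Finset α)) (Finpartition.empty (Finset α))
    (fun π hπ => (hπ (h π)).elim)).trans prod_empty

/-- Sort the partitions by the block `insert a u` containing `a`; the other blocks partition `t \
u`. -/
lemma partitionSum_insert {α : Type} [DecidableEq α] (κ : ℕ+ → ℝ) {a : α} {t : Finset α}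
    (ha : a ∉ t) :
    partitionSum κ (insert a t) =
      ∑ u ∈ t.powerset, κ u.card.succPNat * partitionSum κ (t \ u) := by
  unfold partitionSum
  simp_rw [mul_sum]
  rw [sum_sigma' t.powerset (fun u => (univ : Finset (Finpartition (t \ u))))
    (fun u ρ => κ u.card.succPNat * ∏ B ∈ ρ.parts, κ B.card.toPNat')]
  symm
  have hsub : ∀ {u : Finset α} (_ : u ⊆ t) (ρ : Finpartition (t \ u)) {B : Finset α},
      B ∈ ρ.parts → a ∉ B := fun _ ρ B hB haB =>
    ha (mem_sdiff.1 (ρ.le hB haB)).1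
  have hdisj : ∀ x : (Σ u : Finset α, Finpartition (t \ u)), Disjoint (t \ x.1) (insert a x.1) := by
    intro x
    rw [disjoint_insert_right]
    exact ⟨fun h => ha (mem_sdiff.1 h).1, sdiff_disjoint⟩
  have hunion : ∀ x : (Σ u : Finset α, Finpartition (t \ u)), x.1 ⊆ t →
      (t \ x.1) ⊔ (insert a x.1) = insert a t := by
    intro x hx
    rw [sup_eq_union, union_insert, sdiff_union_of_subset hx]
  refine sum_bij
    (fun x hx => x.2.extend (b := insert a x.1) (insert_ne_empty _ _) (hdisj x)
      (hunion x (mem_powerset.1 (mem_sigma.1 hx).1))) (fun _ _ => mem_univ _) ?_ ?_ ?_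
  · rintro ⟨u, ρ⟩ hu ⟨v, σ⟩ hv h
    have hu' := mem_powerset.1 (mem_sigma.1 hu).1
    have hv' := mem_powerset.1 (mem_sigma.1 hv).1
    have hp := congrArg Finpartition.parts h
    simp only [Finpartition.extend_parts] at hp
    have huv : insert a u = insert a v := by
      have : insert a u ∈ insert (insert a v) σ.parts := hp ▸ mem_insert_self _ _
      rcases mem_insert.1 this with h1 | h1
      · exact h1
      · exact (hsub hv' σ h1 (mem_insert_self _ _)).elim
    have huv' : u = v := by
      have := congrArg (fun s => s.erase a) huv
      simpa [erase_insert (fun h => ha (hu' h)), erase_insert (fun h => ha (hv' h))] using this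
    subst huv'
    have hρσ : ρ = σ := by
      apply Finpartition.ext
      have := congrArg (fun s => s.erase (insert a u)) hp
      simpa [erase_insert (fun h => hsub hu' ρ h (mem_insert_self _ _)),
        erase_insert (fun h => hsub hu' σ h (mem_insert_self _ _))] using this
    rw [hρσ]
  · intro π _
    -- The preimage of `π`: delete the block of `a`, and remember that block without `a`.
    set b := π.part a with hb
    have hamem : a ∈ b := π.mem_part_self.2 (mem_insert_self _ _)
    have hbmem : b ∈ π.parts := π.part_mem.2 (mem_insert_self _ _)
    have hbins : insert a (b.erase a) = b := insert_erase hamem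
    have hbs : b.erase a ⊆ t := by
      intro x hx
      rcases mem_insert.1 (π.le hbmem (mem_of_mem_erase hx)) with h | h
      · exact (ne_of_mem_erase hx h).elim
      · exact h
    have hset : insert a t \ b = t \ b.erase a := by
      ext x
      by_cases hx : x = a
      · subst hx; simp [hamem, ha]
      · simp [hx]
    refine ⟨⟨b.erase a, (π.avoid b).copy hset⟩,
      mem_sigma.2 ⟨mem_powerset.2 hbs, mem_univ _⟩, ?_⟩
    apply Finpartition.ext
    simp only [Finpartition.extend_parts, hbins]
    ext B
    simp only [mem_insert, Finpartition.copy, Finpartition.mem_avoid]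
    constructor
    · rintro (rfl | ⟨d, hd, hdb, rfl⟩)
      · exact hbmem
      · have hne : d ≠ b := fun h => hdb h.le
        rw [sdiff_eq_self_of_disjoint (show Disjoint d b from π.disjoint hd hbmem hne)]
        exact hd
    · intro hB
      by_cases h : B = b
      · exact Or.inl h
      · have hd : Disjoint B b := π.disjoint hB hbmem h
        refine Or.inr ⟨B, hB, fun hle => ?_, sdiff_eq_self_of_disjoint hd⟩
        exact π.ne_bot hB (hd.eq_bot_of_le hle)
  · rintro ⟨u, ρ⟩ hu
    have hu' := mem_powerset.1 (mem_sigma.1 hu).1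
    simp only [Finpartition.extend_parts]
    rw [prod_insert (fun h => hsub hu' ρ h (mem_insert_self _ _)),
      card_insert_of_notMem (fun h => ha (hu' h))]
    rfl

lemma partitionSum_eq_of_card_eq {α β : Type} [DecidableEq α] [DecidableEq β] (κ : ℕ+ → ℝ)
    (s : Finset α) (t : Finset β) (h : s.card = t.card) :
    partitionSum κ s = partitionSum κ t := by
  -- One value serves all sets of size `n` in both types, so that the recursion can be evaluated
  -- term by term.
  suffices H : ∀ n, ∃ x : ℝ, ∀ s : Finset α, s.card = n → ∀ t : Finset β, t.card = n →
      partitionSum κ s = x ∧ partitionSum κ t = x by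
    obtain ⟨x, hx⟩ := H s.card
    have := hx s rfl t h.symm
    rw [this.1, this.2]
  intro n
  induction n using Nat.strong_induction_on with
  | _ n ih =>
    choose! x hx using ih
    rcases n with _ | n
    · refine ⟨1, fun s hs t ht => ?_⟩
      rw [card_eq_zero] at hs ht
      subst hs ht
      exact ⟨partitionSum_empty κ, partitionSum_empty κ⟩
    · refine ⟨∑ i ∈ range (n + 1), n.choose i • (κ i.succPNat * x (n - i)), fun s hs t ht => ?_⟩
      obtain ⟨a, s, ha, rfl, hs'⟩ := card_eq_succ.1 hs
      obtain ⟨b, t, hb, rfl, ht'⟩ := card_eq_succ.1 ht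
      -- The induction hypothesis speaks of pairs of sets, so each subset needs a companion of equal
      -- size in the other type.
      have aux : ∀ i ≤ n, ∃ u ⊆ s, ∃ v ⊆ t, u.card = i ∧ v.card = i := by
        intro i hi
        obtain ⟨u, hu, hu'⟩ := exists_subset_card_eq (hi.trans hs'.ge)
        obtain ⟨v, hv, hv'⟩ := exists_subset_card_eq (hi.trans ht'.ge)
        exact ⟨u, hu, v, hv, hu', hv'⟩
      have hcs : ∀ u ⊆ s, (s \ u).card = n - u.card := fun u hu => by
        rw [card_sdiff_of_subset hu, hs']
      have hct : ∀ u ⊆ t, (t \ u).card = n - u.card := fun u hu => by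
        rw [card_sdiff_of_subset hu, ht']
      constructor
      · rw [partitionSum_insert κ ha, ← hs', ← sum_powerset_apply_card
          (fun i => κ i.succPNat * x (s.card - i))]
        refine sum_congr rfl fun u hu => ?_
        rw [mem_powerset] at hu
        obtain ⟨_, _, v, hv, _, hv'⟩ := aux u.card (hs' ▸ card_le_card hu)
        rw [hs', (hx (n - u.card) (by omega) _ (hcs u hu) (t \ v) (hv' ▸ hct v hv)).1]
      · rw [partitionSum_insert κ hb, ← ht', ← sum_powerset_apply_card
          (fun i => κ i.succPNat * x (t.card - i))]
        refine sum_congr rfl fun v hv => ?_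
        rw [mem_powerset] at hv
        obtain ⟨u, hu, _, _, hu', _⟩ := aux v.card (ht' ▸ card_le_card hv)
        rw [ht', (hx (n - v.card) (by omega) (s \ u) (hu' ▸ hcs u hu) _ (hct v hv)).2]

/-- The sum over set partitions of an `n`-element set; the `n`-th moment, including `n = 0`. -/
noncomputable def momentSeq (κ : ℕ+ → ℝ) (n : ℕ) : ℝ := partitionSum κ (univ : Finset (Fin n))

lemma momentSeq_zero (κ : ℕ+ → ℝ) : momentSeq κ 0 = 1 := partitionSum_empty κ

lemma classicalCumulantToMoment_apply (κ : ℕ+ → ℝ) (n : ℕ+) :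
    classicalCumulantToMoment κ n = momentSeq κ n := rfl

lemma momentSeq_succ (κ : ℕ+ → ℝ) (n : ℕ) :
    momentSeq κ (n + 1) =
      ∑ i ∈ range (n + 1), n.choose i * (κ i.succPNat * momentSeq κ (n - i)) := by
  have h : momentSeq κ (n + 1) = partitionSum κ (insert n (range n)) :=
    partitionSum_eq_of_card_eq _ _ _ (by simp)
  rw [h, partitionSum_insert κ (by simp)]
  have h2 := sum_powerset_apply_card (fun i => κ i.succPNat * momentSeq κ (n - i)) (x := range n)
  simp only [card_range, nsmul_eq_mul] at h2
  rw [← h2]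
  refine sum_congr rfl fun u hu => ?_
  rw [momentSeq, partitionSum_eq_of_card_eq κ (range n \ u) (univ : Finset (Fin (n - u.card)))]
  rw [card_sdiff_of_subset (mem_powerset.1 hu)]
  simp

/-! ### Exponential generating functions -/

/-- The derivative of the exponential generating function of the cumulants. -/
noncomputable def cumulantEgfDeriv (κ : ℕ+ → ℝ) : PowerSeries ℝ :=
  PowerSeries.mk fun n => κ n.succPNat / n.factorial

/-- The exponential generating function of the moments. -/
noncomputable def momentEgf (κ : ℕ+ → ℝ) : PowerSeries ℝ :=
  PowerSeries.mk fun n => momentSeq κ n / n.factorial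

lemma constantCoeff_momentEgf (κ : ℕ+ → ℝ) : constantCoeff (momentEgf κ) = 1 := by
  rw [← coeff_zero_eq_constantCoeff_apply, momentEgf, coeff_mk, momentSeq_zero]
  simp

lemma derivative_momentEgf (κ : ℕ+ → ℝ) :
    PowerSeries.derivative ℝ (momentEgf κ) = cumulantEgfDeriv κ * momentEgf κ := by
  ext n
  rw [coeff_derivative, coeff_mul, Nat.sum_antidiagonal_eq_sum_range_succ
    (fun i j => coeff i (cumulantEgfDeriv κ) * coeff j (momentEgf κ))]
  simp only [momentEgf, cumulantEgfDeriv, coeff_mk]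
  rw [momentSeq_succ, Nat.factorial_succ, sum_div, sum_mul]
  refine sum_congr rfl fun i hi => ?_
  have hi' : i ≤ n := by simpa [Nat.lt_succ_iff] using hi
  have hc : (n.choose i : ℝ) = n.factorial / (i.factorial * (n - i).factorial) :=
    Nat.cast_choose ℝ hi'
  have h1 : (n.factorial : ℝ) ≠ 0 := by positivity
  have h2 : (i.factorial : ℝ) ≠ 0 := by positivity
  have h3 : ((n - i).factorial : ℝ) ≠ 0 := by positivity
  have h4 : (n + 1 : ℝ) ≠ 0 := by positivity
  rw [hc]
  push_cast
  field_simp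

/-- If `f' = G f`, then `f · (∂ + G)^n 1 = ∂^n f`. -/
lemma mul_iterate_derivative_add_mul {G f : PowerSeries ℝ}
    (hf : PowerSeries.derivative ℝ f = G * f) (n : ℕ) :
    f * (fun u => PowerSeries.derivative ℝ u + G * u)^[n] 1 =
      (PowerSeries.derivative ℝ)^[n] f := by
  induction n with
  | zero => simp
  | succ n ih =>
    rw [Function.iterate_succ_apply', Function.iterate_succ_apply', ← ih, Derivation.leibniz, hf]
    simp only [smul_eq_mul]
    ring

lemma constantCoeff_iterate_derivative_add_mul {G f : PowerSeries ℝ}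
    (hf : PowerSeries.derivative ℝ f = G * f) (h1 : constantCoeff f = 1) (n : ℕ) :
    constantCoeff ((fun u => PowerSeries.derivative ℝ u + G * u)^[n] 1) =
      n.factorial * coeff n f := by
  have h := congrArg constantCoeff (mul_iterate_derivative_add_mul hf n)
  rw [map_mul, h1, one_mul, constantCoeff_iterate_derivative] at h
  simpa using h

/-- The equation `f' = Gf` with `f(0) = 1` determines `f`: its coefficients are read off from `(∂ +
G)^n 1`, which involves `G` only. -/
lemma classicalCumulantToMoment_eq_of_derivative_eq {κ : ℕ+ → ℝ} {f : PowerSeries ℝ}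
    (hf : PowerSeries.derivative ℝ f = cumulantEgfDeriv κ * f) (h1 : constantCoeff f = 1)
    (n : ℕ+) : classicalCumulantToMoment κ n = (n : ℕ).factorial * coeff n f := by
  rw [← constantCoeff_iterate_derivative_add_mul hf h1,
    constantCoeff_iterate_derivative_add_mul (derivative_momentEgf κ) (constantCoeff_momentEgf κ),
    momentEgf, coeff_mk, classicalCumulantToMoment_apply]
  field_simp

lemma cumulantEgfDeriv_add (κ κ' : ℕ+ → ℝ) :
    cumulantEgfDeriv (κ + κ') = cumulantEgfDeriv κ + cumulantEgfDeriv κ' := by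
  ext n
  simp [cumulantEgfDeriv, add_div]

/-- By the Leibniz rule the product of the two moment series solves the equation for `κ + κ'`. -/
lemma classicalCumulantToMoment_add (κ κ' : ℕ+ → ℝ) (n : ℕ+) :
    classicalCumulantToMoment (κ + κ') n =
      ∑ i ∈ range (n + 1), (n : ℕ).choose i * (momentSeq κ i * momentSeq κ' (n - i)) := by
  rw [classicalCumulantToMoment_eq_of_derivative_eq (f := momentEgf κ * momentEgf κ'), coeff_mul,
    Nat.sum_antidiagonal_eq_sum_range_succ
      (fun i j => coeff i (momentEgf κ) * coeff j (momentEgf κ')), mul_sum]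
  · refine sum_congr rfl fun i hi => ?_
    have hi' : i ≤ n := by simpa [Nat.lt_succ_iff] using hi
    rw [Nat.cast_choose ℝ hi', momentEgf, momentEgf, coeff_mk, coeff_mk]
    field_simp
  · rw [Derivation.leibniz, derivative_momentEgf, derivative_momentEgf, cumulantEgfDeriv_add]
    simp only [smul_eq_mul]
    ring
  · rw [map_mul, constantCoeff_momentEgf, constantCoeff_momentEgf, one_mul]

/-! ### The deformed moment map and its continuity -/

/-- The operator from even to odd series, in rescaled coordinates. -/
noncomputable def oddStep (γ : ℝ) (G f : PowerSeries ℝ) : PowerSeries ℝ :=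
  PowerSeries.derivative ℝ f + γ • lowerOp f + G * f

/-- The operator from odd to even series, in rescaled coordinates. -/
noncomputable def evenStep (ε : ℝ) (G f : PowerSeries ℝ) : PowerSeries ℝ :=
  f + ε • (X * (PowerSeries.derivative ℝ f + G * f))

/-- The moments as functions of the rescaled cumulants, for `ε = 1 / (qγ)`. -/
noncomputable def deformedMoment (γ ε : ℝ) (κ : ℕ+ → ℝ) : ℕ+ → ℝ := fun j =>
  constantCoeff ((fun f => evenStep ε (cumulantEgfDeriv κ)
    (oddStep γ (cumulantEgfDeriv κ) f))^[(j : ℕ)] 1)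

lemma deformedMoment_zero_zero (κ : ℕ+ → ℝ) :
    deformedMoment 0 0 κ = classicalCumulantToMoment κ := by
  funext n
  rw [classicalCumulantToMoment_eq_of_derivative_eq (derivative_momentEgf κ)
    (constantCoeff_momentEgf κ), ← constantCoeff_iterate_derivative_add_mul
    (derivative_momentEgf κ) (constantCoeff_momentEgf κ)]
  simp [deformedMoment, evenStep, oddStep]

section Continuity

variable {ι : Type*} {l : Filter ι}

lemma tendsto_derivative {f : ι → PowerSeries ℝ} {f₀ : PowerSeries ℝ} (hf : Tendsto f l (𝓝 f₀)) :
    Tendsto (fun i => PowerSeries.derivative ℝ (f i)) l (𝓝 (PowerSeries.derivative ℝ f₀)) := by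
  rw [PowerSeries.WithPiTopology.tendsto_iff_coeff_tendsto] at hf ⊢
  intro n
  simp only [coeff_derivative]
  exact (hf (n + 1)).mul_const _

lemma tendsto_lowerOp {f : ι → PowerSeries ℝ} {f₀ : PowerSeries ℝ} (hf : Tendsto f l (𝓝 f₀)) :
    Tendsto (fun i => lowerOp (f i)) l (𝓝 (lowerOp f₀)) := by
  rw [PowerSeries.WithPiTopology.tendsto_iff_coeff_tendsto] at hf ⊢
  intro n
  simpa only [lowerOp, coeff_mk] using hf (n + 1)

lemma tendsto_smul_powerSeries {γ : ι → ℝ} {γ₀ : ℝ} {f : ι → PowerSeries ℝ} {f₀ : PowerSeries ℝ}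
    (hγ : Tendsto γ l (𝓝 γ₀)) (hf : Tendsto f l (𝓝 f₀)) :
    Tendsto (fun i => γ i • f i) l (𝓝 (γ₀ • f₀)) := by
  rw [PowerSeries.WithPiTopology.tendsto_iff_coeff_tendsto] at hf ⊢
  intro n
  simpa only [coeff_smul, smul_eq_mul] using hγ.mul (hf n)

lemma tendsto_cumulantEgfDeriv {κ : ι → ℕ+ → ℝ} {κ₀ : ℕ+ → ℝ} (hκ : Tendsto κ l (𝓝 κ₀)) :
    Tendsto (fun i => cumulantEgfDeriv (κ i)) l (𝓝 (cumulantEgfDeriv κ₀)) := by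
  rw [PowerSeries.WithPiTopology.tendsto_iff_coeff_tendsto]
  intro n
  simp only [cumulantEgfDeriv, coeff_mk]
  exact ((tendsto_pi_nhds.1 hκ) _).div_const _

/-- Every operation in a step is continuous for coefficientwise convergence. -/
lemma tendsto_deformedMoment {γ ε : ι → ℝ} {γ₀ ε₀ : ℝ} {κ : ι → ℕ+ → ℝ} {κ₀ : ℕ+ → ℝ}
    (hγ : Tendsto γ l (𝓝 γ₀)) (hε : Tendsto ε l (𝓝 ε₀)) (hκ : Tendsto κ l (𝓝 κ₀)) :
    Tendsto (fun i => deformedMoment (γ i) (ε i) (κ i)) l (𝓝 (deformedMoment γ₀ ε₀ κ₀)) := by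
  have hG := tendsto_cumulantEgfDeriv hκ
  rw [tendsto_pi_nhds]
  intro j
  refine ((PowerSeries.WithPiTopology.continuous_constantCoeff ℝ).tendsto _).comp ?_
  induction (j : ℕ) with
  | zero => exact tendsto_const_nhds
  | succ n ih =>
    simp only [Function.iterate_succ_apply']
    have ho := ((tendsto_derivative ih).add
      (tendsto_smul_powerSeries hγ (tendsto_lowerOp ih))).add (hG.mul ih)
    exact ho.add (tendsto_smul_powerSeries hε
      (tendsto_const_nhds.mul ((tendsto_derivative ho).add (hG.mul ho))))

end Continuity

/-! ### Triangularity and inversion of the deformed map -/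

/-- The sequence `κ` with the entries from the index `j` on replaced by `0`. -/
noncomputable def truncBelow (j : ℕ+) (κ : ℕ+ → ℝ) : ℕ+ → ℝ := fun i => if i < j then κ i else 0

/-- The coefficient of `κ_{n+1}` in `[t^{n-i}]` of the `(i+1)`-st iterate. -/
noncomputable def leadCoeff (γ ε : ℝ) (n : ℕ) : ℕ → ℝ
  | 0 => (1 + ε * n) / n.factorial
  | i + 1 => (1 + ε * (n - (i + 1))) * ((n - i + γ) * leadCoeff γ ε n i)

lemma leadCoeff_pos {γ ε : ℝ} (hγ : 0 ≤ γ) (hε : 0 ≤ ε) {n i : ℕ} (hi : i ≤ n) :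
    0 < leadCoeff γ ε n i := by
  induction i with
  | zero => unfold leadCoeff; positivity
  | succ i ih =>
    have h1 : ((i + 1 : ℕ) : ℝ) ≤ n := by exact_mod_cast hi
    push_cast at h1
    have h2 : 0 ≤ ε * (n - (i + 1)) := mul_nonneg hε (by linarith)
    exact mul_pos (by linarith) (mul_pos (by linarith) (ih (by omega)))

lemma tendsto_leadCoeff {ι : Type*} {l : Filter ι} {γ ε : ι → ℝ} {γ₀ ε₀ : ℝ}
    (hγ : Tendsto γ l (𝓝 γ₀)) (hε : Tendsto ε l (𝓝 ε₀)) (n i : ℕ) :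
    Tendsto (fun x => leadCoeff (γ x) (ε x) n i) l (𝓝 (leadCoeff γ₀ ε₀ n i)) := by
  induction i with
  | zero => exact ((hε.mul_const _).const_add _).div_const _
  | succ i ih => exact ((hε.mul_const _).const_add _).mul ((hγ.const_add _).mul ih)

/-- Two series that agree in degrees below `N` and whose coefficients of degree `N` differ
by `c`. -/
def AgreeUpTo (N : ℕ) (c : ℝ) (f f' : PowerSeries ℝ) : Prop :=
  (∀ n < N, coeff n f = coeff n f') ∧ coeff N f = c + coeff N f'

lemma coeff_mul_congr {n : ℕ} {f f' g g' : PowerSeries ℝ}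
    (hf : ∀ i ≤ n, coeff i f = coeff i f') (hg : ∀ i ≤ n, coeff i g = coeff i g') :
    coeff n (f * g) = coeff n (f' * g') := by
  rw [coeff_mul, coeff_mul]
  refine sum_congr rfl fun x hx => ?_
  have := mem_antidiagonal.1 hx
  rw [hf _ (by omega), hg _ (by omega)]

/-- Only `∂` and `lowerOp` bring the discrepancy from degree `N + 1` down to `N`; the product with
`G` sees only coefficients that agree. -/
lemma AgreeUpTo.oddStep {N : ℕ} {c γ : ℝ} {f f' G G' : PowerSeries ℝ}
    (hf : AgreeUpTo (N + 1) c f f') (hG : ∀ n ≤ N, coeff n G = coeff n G') :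
    AgreeUpTo N ((N + 1 + γ) * c) (oddStep γ G f) (oddStep γ G' f') := by
  refine ⟨fun n hn => ?_, ?_⟩
  · simp only [_root_.oddStep, map_add, coeff_derivative, coeff_smul, lowerOp, coeff_mk]
    rw [hf.1 _ (by omega), coeff_mul_congr (fun i hi => hG i (by omega))
      (fun i hi => hf.1 i (by omega))]
  · simp only [_root_.oddStep, map_add, coeff_derivative, coeff_smul, lowerOp, coeff_mk, smul_eq_mul]
    rw [hf.2, coeff_mul_congr (fun i hi => hG i (by omega)) (fun i hi => hf.1 i (by omega))]
    ring

/-- The factor `X` offsets the derivative, so the discrepancy stays in degree `N`; the term `X * (G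
* f)` sees only lower degrees. -/
lemma AgreeUpTo.evenStep {N : ℕ} {c ε : ℝ} {f f' G G' : PowerSeries ℝ}
    (hf : AgreeUpTo N c f f') (hG : ∀ n < N, coeff n G = coeff n G') :
    AgreeUpTo N ((1 + ε * N) * c) (evenStep ε G f) (evenStep ε G' f') := by
  refine ⟨fun n hn => ?_, ?_⟩
  · simp only [_root_.evenStep, map_add, coeff_smul]
    rw [hf.1 _ hn]
    rcases n with _ | n
    · simp
    · rw [coeff_succ_X_mul, coeff_succ_X_mul]
      simp only [map_add, coeff_derivative]
      rw [hf.1 _ hn, coeff_mul_congr (fun i hi => hG i (by omega))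
        (fun i hi => hf.1 i (by omega))]
  · simp only [_root_.evenStep, map_add, coeff_smul]
    rcases N with _ | N
    · simp [hf.2]
    · rw [coeff_succ_X_mul, coeff_succ_X_mul]
      simp only [map_add, coeff_derivative]
      rw [hf.2, coeff_mul_congr (fun i hi => hG i (by omega))
        (fun i hi => hf.1 i (by omega))]
      simp only [smul_eq_mul]
      push_cast
      ring

lemma agreeUpTo_cumulantEgfDeriv (κ : ℕ+ → ℝ) (n : ℕ) :
    AgreeUpTo n (κ n.succPNat / n.factorial) (cumulantEgfDeriv κ)
      (cumulantEgfDeriv (truncBelow n.succPNat κ)) := by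
  refine ⟨fun i hi => ?_, ?_⟩
  · simp [cumulantEgfDeriv, truncBelow, hi]
  · simp [cumulantEgfDeriv, truncBelow]

/-- The cumulant of index `n + 1` first enters `G` in degree `n`. The first round puts it in degree
`n` of the iterate, and each of the `n` further rounds lowers it by one degree, so it reaches the
constant term linearly. -/
lemma deformedMoment_eq_add (γ ε : ℝ) (κ : ℕ+ → ℝ) (n : ℕ) :
    deformedMoment γ ε κ n.succPNat = leadCoeff γ ε n n * κ n.succPNat +
      deformedMoment γ ε (truncBelow n.succPNat κ) n.succPNat := by
  have hG := agreeUpTo_cumulantEgfDeriv κ n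
  unfold deformedMoment
  set G := cumulantEgfDeriv κ
  set G' := cumulantEgfDeriv (truncBelow n.succPNat κ)
  have key : ∀ i N, N + i = n → AgreeUpTo N (leadCoeff γ ε n i * κ n.succPNat)
      ((fun f => evenStep ε G (oddStep γ G f))^[i + 1] 1)
      ((fun f => evenStep ε G' (oddStep γ G' f))^[i + 1] 1) := by
    intro i
    induction i with
    | zero =>
      rintro N rfl
      have h0 : ∀ H : PowerSeries ℝ, oddStep γ H 1 = H := by
        intro H
        have : lowerOp 1 = 0 := by ext n; simp [lowerOp, coeff_one]
        simp [oddStep, this]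
      simp only [zero_add, Function.iterate_one, h0]
      have h := hG.evenStep (ε := ε) hG.1
      simp only [add_zero] at h ⊢
      convert! h using 1
      unfold leadCoeff
      ring
    | succ i ih =>
      rintro N rfl
      have h := ih (N + 1) (by omega)
      have h1 := (h.oddStep (γ := γ) (fun k hk => hG.1 k (by omega))).evenStep (ε := ε)
        (fun k hk => hG.1 k (by omega))
      rw [Function.iterate_succ_apply' _ (i + 1), Function.iterate_succ_apply' _ (i + 1)]
      convert! h1 using 1
      rw [leadCoeff]
      push_cast
      ring
  simpa using (key n 0 (by omega)).2

lemma truncBelow_congr {j : ℕ+} {κ κ' : ℕ+ → ℝ} (h : ∀ i < j, κ i = κ' i) :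
    truncBelow j κ = truncBelow j κ' := by
  funext i
  unfold truncBelow
  split_ifs with hi
  exacts [h i hi, rfl]

lemma deformedMoment_injective {γ ε : ℝ} (hγ : 0 ≤ γ) (hε : 0 ≤ ε) :
    Function.Injective (deformedMoment γ ε) := by
  intro κ κ' h
  funext j
  induction j using PNat.strongInductionOn with
  | _ j ih =>
    obtain ⟨n, rfl⟩ : ∃ n : ℕ, n.succPNat = j := ⟨j.natPred, PNat.succPNat_natPred j⟩
    have h1 := congrFun h n.succPNat
    rw [deformedMoment_eq_add, deformedMoment_eq_add γ ε κ', truncBelow_congr ih] at h1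
    exact mul_left_cancel₀ (leadCoeff_pos hγ hε le_rfl).ne' (add_right_cancel h1)

/-- The cumulants of a moment sequence, by recursion on the index. -/
noncomputable def deformedCumulant (γ ε : ℝ) (m : ℕ+ → ℝ) (j : ℕ+) : ℝ :=
  (m j - deformedMoment γ ε (fun i => if _h : i < j then deformedCumulant γ ε m i else 0) j) /
    leadCoeff γ ε j.natPred j.natPred
termination_by j

lemma deformedMoment_deformedCumulant {γ ε : ℝ} (hγ : 0 ≤ γ) (hε : 0 ≤ ε) (m : ℕ+ → ℝ) :
    deformedMoment γ ε (deformedCumulant γ ε m) = m := by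
  funext j
  obtain ⟨n, rfl⟩ : ∃ n : ℕ, n.succPNat = j := ⟨j.natPred, PNat.succPNat_natPred j⟩
  rw [deformedMoment_eq_add]
  have h : truncBelow n.succPNat (deformedCumulant γ ε m) =
      fun i => if _h : i < n.succPNat then deformedCumulant γ ε m i else 0 := by
    funext i; simp [truncBelow]
  rw [h]
  nth_rewrite 1 [deformedCumulant]
  rw [Nat.natPred_succPNat, mul_div_cancel₀ _ (leadCoeff_pos hγ hε le_rfl).ne']
  ring

lemma deformedMoment_bijective {γ ε : ℝ} (hγ : 0 ≤ γ) (hε : 0 ≤ ε) :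
    Function.Bijective (deformedMoment γ ε) :=
  ⟨deformedMoment_injective hγ hε, fun m => ⟨_, deformedMoment_deformedCumulant hγ hε m⟩⟩

/-- Solve `deformedMoment_eq_add` for the top cumulant: the lower ones converge by induction, and
the diagonal entry has a nonzero limit. -/
lemma tendsto_of_tendsto_deformedMoment {ι : Type*} {l : Filter ι} {γ ε : ι → ℝ} {γ₀ ε₀ : ℝ}
    {κ : ι → ℕ+ → ℝ} {κ₀ : ℕ+ → ℝ} (hγ₀ : 0 ≤ γ₀) (hε₀ : 0 ≤ ε₀)
    (hγ : Tendsto γ l (𝓝 γ₀)) (hε : Tendsto ε l (𝓝 ε₀))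
    (h : Tendsto (fun i => deformedMoment (γ i) (ε i) (κ i)) l (𝓝 (deformedMoment γ₀ ε₀ κ₀))) :
    Tendsto κ l (𝓝 κ₀) := by
  rw [tendsto_pi_nhds]
  intro j
  induction j using PNat.strongInductionOn with
  | _ j ih =>
    obtain ⟨n, rfl⟩ : ∃ n : ℕ, n.succPNat = j := ⟨j.natPred, PNat.succPNat_natPred j⟩
    have ht : Tendsto (fun i => truncBelow n.succPNat (κ i)) l (𝓝 (truncBelow n.succPNat κ₀)) := by
      rw [tendsto_pi_nhds]
      intro k
      unfold truncBelow
      split_ifs with hk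
      exacts [ih k hk, tendsto_const_nhds]
    have h1 := tendsto_pi_nhds.1 h n.succPNat
    have h2 := tendsto_pi_nhds.1 (tendsto_deformedMoment hγ hε ht) n.succPNat
    have hne : leadCoeff γ₀ ε₀ n n ≠ 0 := (leadCoeff_pos hγ₀ hε₀ le_rfl).ne'
    have hL := tendsto_leadCoeff hγ hε n n
    have h3 := (h1.sub h2).div hL hne
    rw [deformedMoment_eq_add γ₀ ε₀ κ₀, add_sub_cancel_right, mul_div_cancel_left₀ _ hne] at h3
    refine h3.congr' ?_
    filter_upwards [hL.eventually_ne hne] with i hi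
    rw [Pi.div_apply, deformedMoment_eq_add, add_sub_cancel_right, mul_div_cancel_left₀ _ hi]

/-! ### Parity decomposition and rescaled coordinates -/

/-- The even series `A(z²/(4s))`. -/
noncomputable def evenExpand (s : ℝ) : PowerSeries ℝ →+* PowerSeries ℝ :=
  (expand 2 two_ne_zero : PowerSeries ℝ →ₐ[ℝ] PowerSeries ℝ).toRingHom.comp
    (rescale (1 / (4 * s)))

lemma coeff_evenExpand_two_mul (s : ℝ) (A : PowerSeries ℝ) (h : ℕ) :
    coeff (2 * h) (evenExpand s A) = (1 / (4 * s)) ^ h * coeff h A := by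
  have := coeff_expand_mul 2 two_ne_zero (rescale (1 / (4 * s)) A) h
  rw [coeff_rescale] at this
  exact this

lemma coeff_evenExpand_two_mul_add_one (s : ℝ) (A : PowerSeries ℝ) (h : ℕ) :
    coeff (2 * h + 1) (evenExpand s A) = 0 :=
  coeff_expand_of_not_dvd 2 two_ne_zero (rescale (1 / (4 * s)) A) (by omega)

lemma constantCoeff_evenExpand (s : ℝ) (A : PowerSeries ℝ) :
    constantCoeff (evenExpand s A) = constantCoeff A := by
  simpa using coeff_evenExpand_two_mul s A 0

lemma evenExpand_X (s : ℝ) : evenExpand s X = (1 / (4 * s)) • X ^ 2 := by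
  have : evenExpand s X = expand 2 two_ne_zero (rescale (1 / (4 * s)) X) := rfl
  rw [this, rescale_X, map_mul, expand_C, expand_X, smul_eq_C_mul]

lemma evenExpand_smul (s c : ℝ) (A : PowerSeries ℝ) :
    evenExpand s (c • A) = c • evenExpand s A := by
  have : ∀ r : ℝ, evenExpand s (C r) = C r := fun r => by
    have : evenExpand s (C r) = expand 2 two_ne_zero (rescale (1 / (4 * s)) (C r)) := rfl
    rw [this, show rescale (1 / (4 * s)) (C r) = C r by
      ext n; rw [coeff_rescale, coeff_C]; split_ifs with h <;> simp [h], expand_C]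
  rw [smul_eq_C_mul, map_mul, this, ← smul_eq_C_mul]

/-- The odd series `z B(z²/(4s)) / (2s)`. -/
noncomputable def oddExpand (s : ℝ) (B : PowerSeries ℝ) : PowerSeries ℝ :=
  (1 / (2 * s)) • (X * evenExpand s B)

lemma coeff_oddExpand_two_mul (s : ℝ) (B : PowerSeries ℝ) (h : ℕ) :
    coeff (2 * h) (oddExpand s B) = 0 := by
  rw [oddExpand, coeff_smul]
  rcases h with _ | h
  · simp
  · rw [show 2 * (h + 1) = 2 * h + 1 + 1 by ring, coeff_succ_X_mul,
      coeff_evenExpand_two_mul_add_one, smul_zero]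

lemma coeff_oddExpand_two_mul_add_one (s : ℝ) (B : PowerSeries ℝ) (h : ℕ) :
    coeff (2 * h + 1) (oddExpand s B) = 1 / (2 * s) * ((1 / (4 * s)) ^ h * coeff h B) := by
  rw [oddExpand, coeff_smul, coeff_succ_X_mul, coeff_evenExpand_two_mul, smul_eq_mul]

lemma oddExpand_add (s : ℝ) (A B : PowerSeries ℝ) :
    oddExpand s (A + B) = oddExpand s A + oddExpand s B := by
  simp [oddExpand, mul_add]

lemma oddExpand_mul_evenExpand (s : ℝ) (A B : PowerSeries ℝ) :
    oddExpand s A * evenExpand s B = oddExpand s (A * B) := by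
  simp [oddExpand, mul_assoc]

/-- This is `(z/(2s))² = (1/s) · z²/(4s)`, the source of `ε = 1/s` in the product term of
`evenStep`. -/
lemma oddExpand_mul_oddExpand {s : ℝ} (hs : s ≠ 0) (A B : PowerSeries ℝ) :
    oddExpand s A * oddExpand s B = evenExpand s ((1 / s) • (X * (A * B))) := by
  rw [evenExpand_smul, map_mul, map_mul, evenExpand_X, oddExpand, oddExpand, smul_mul_smul_comm,
    smul_mul_assoc, smul_smul]
  congr 1
  · field_simp
    norm_num
  · ring

lemma eq_of_coeff_parity {f f' : PowerSeries ℝ} (h0 : ∀ h, coeff (2 * h) f = coeff (2 * h) f')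
    (h1 : ∀ h, coeff (2 * h + 1) f = coeff (2 * h + 1) f') : f = f' := by
  ext n
  rcases Nat.even_or_odd' n with ⟨h, rfl | rfl⟩
  exacts [h0 h, h1 h]

/-- The part of `qgOperator` that lowers the degree. -/
noncomputable def qgLower (q γ : ℝ) (f : PowerSeries ℝ) : PowerSeries ℝ :=
  PowerSeries.derivative ℝ f + (2 * γ) • lowerOp f + ((q - 1) * γ - 1 / 2) • oddLowerOp f

/-- The `-1/2` in the coefficient of `d'` cancels the `1` in `2h + 1`, and the `γ` terms add up to
`2qγ`. -/
lemma coeff_qgLower_two_mul (q γ : ℝ) (f : PowerSeries ℝ) (h : ℕ) :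
    coeff (2 * h) (qgLower q γ f) = (2 * h + 2 * (q * γ)) * coeff (2 * h + 1) f := by
  have : Odd (2 * h + 1) := odd_two_mul_add_one h
  simp only [qgLower, map_add, coeff_derivative, coeff_smul, lowerOp, oddLowerOp, coeff_mk, this,
    if_true, smul_eq_mul]
  push_cast
  ring

lemma coeff_qgLower_two_mul_add_one (q γ : ℝ) (f : PowerSeries ℝ) (h : ℕ) :
    coeff (2 * h + 1) (qgLower q γ f) = (2 * (h + 1) + 2 * γ) * coeff (2 * (h + 1)) f := by
  have : ¬ Odd (2 * h + 1 + 1) := by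
    rw [Nat.not_odd_iff_even]; exact ⟨h + 1, by ring⟩
  simp only [qgLower, map_add, coeff_derivative, coeff_smul, lowerOp, oddLowerOp, coeff_mk, this,
    if_false, smul_eq_mul]
  rw [show 2 * (h + 1) = 2 * h + 1 + 1 by ring]
  push_cast
  ring

lemma qgLower_evenExpand (q γ : ℝ) (A : PowerSeries ℝ) :
    qgLower q γ (evenExpand (q * γ) A) =
      oddExpand (q * γ) (PowerSeries.derivative ℝ A + γ • lowerOp A) := by
  refine eq_of_coeff_parity (fun h => ?_) (fun h => ?_)
  · rw [coeff_qgLower_two_mul, coeff_evenExpand_two_mul_add_one, coeff_oddExpand_two_mul, mul_zero]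
  · rw [coeff_qgLower_two_mul_add_one, coeff_evenExpand_two_mul, coeff_oddExpand_two_mul_add_one]
    simp only [map_add, coeff_derivative, coeff_smul, lowerOp, coeff_mk, smul_eq_mul]
    rw [pow_succ, show 1 / (2 * (q * γ)) = 2 * (1 / (4 * (q * γ))) by field_simp; norm_num]
    ring

lemma qgLower_oddExpand {q γ : ℝ} (hs : q * γ ≠ 0) (B : PowerSeries ℝ) :
    qgLower q γ (oddExpand (q * γ) B) =
      evenExpand (q * γ) (B + (1 / (q * γ)) • (X * PowerSeries.derivative ℝ B)) := by
  refine eq_of_coeff_parity (fun h => ?_) (fun h => ?_)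
  · rw [coeff_qgLower_two_mul, coeff_evenExpand_two_mul, coeff_oddExpand_two_mul_add_one]
    have : coeff h (X * PowerSeries.derivative ℝ B) = h * coeff h B := by
      rcases h with _ | h
      · simp
      · rw [coeff_succ_X_mul, coeff_derivative]
        push_cast
        ring
    rw [map_add, coeff_smul, this, smul_eq_mul]
    have h1 : (2 * h + 2 * (q * γ)) * (1 / (2 * (q * γ))) = 1 + 1 / (q * γ) * h := by
      generalize q * γ = s at hs ⊢
      field_simp
      ring
    rw [← mul_assoc, h1]
    ring
  · rw [coeff_qgLower_two_mul_add_one, coeff_oddExpand_two_mul, coeff_evenExpand_two_mul_add_one,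
      mul_zero]

lemma qgOperator_evenExpand (q γ : ℝ) (G A : PowerSeries ℝ) :
    qgOperator q γ (oddExpand (q * γ) G) (evenExpand (q * γ) A) =
      oddExpand (q * γ) (oddStep γ G A) := by
  rw [oddStep, oddExpand_add, ← qgLower_evenExpand, ← oddExpand_mul_evenExpand]
  rfl

lemma qgOperator_oddExpand {q γ : ℝ} (hs : q * γ ≠ 0) (G B : PowerSeries ℝ) :
    qgOperator q γ (oddExpand (q * γ) G) (oddExpand (q * γ) B) =
      evenExpand (q * γ) (evenStep (1 / (q * γ)) G B) := by
  rw [evenStep, mul_add, smul_add, ← add_assoc, map_add, ← qgLower_oddExpand hs,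
    ← oddExpand_mul_oddExpand hs]
  rfl

/-- Explains the normalisation of the rescaled cumulants: `s^l 2^(2l-1) (l-1)! = 2s (4s)^(l-1)
(l-1)!`. -/
lemma cumulantSeries_eq_oddExpand {q γ : ℝ} (hs : q * γ ≠ 0) {k : ℕ+ → ℝ}
    (hk : k ∈ oddVanishing) :
    cumulantSeries k = oddExpand (q * γ) (cumulantEgfDeriv (rescaledCumulant q γ k)) := by
  refine eq_of_coeff_parity (fun h => ?_) (fun h => ?_)
  · rw [coeff_oddExpand_two_mul, cumulantSeries, coeff_mk]
    exact hk _ (odd_two_mul_add_one h)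
  · rw [coeff_oddExpand_two_mul_add_one, cumulantSeries, cumulantEgfDeriv, coeff_mk, coeff_mk,
      rescaledCumulant]
    have h1 : (2 * h + 1).succPNat = 2 * h.succPNat := by
      apply PNat.eq
      simp only [Nat.succPNat_coe, PNat.mul_coe, Nat.succ_eq_add_one]
      norm_num
      ring
    have h2 : 2 * (h + 1) - 1 = 2 * h + 1 := by omega
    rw [h1]
    simp only [Nat.succPNat_coe, Nat.succ_eq_add_one, Nat.add_sub_cancel, h2]
    generalize q * γ = s at hs ⊢
    have h3 : (h.factorial : ℝ) ≠ 0 := by positivity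
    rw [pow_succ 2 (2 * h), pow_mul, div_pow, mul_pow, one_pow, pow_succ s]
    norm_num
    field_simp

lemma qgCumulantToMoment_eq {q γ : ℝ} (hs : q * γ ≠ 0) {k : ℕ+ → ℝ} (hk : k ∈ oddVanishing) :
    qgCumulantToMoment q γ k = deformedMoment γ (1 / (q * γ)) (rescaledCumulant q γ k) := by
  funext j
  have h0 : qgOperator q γ (cumulantSeries k) 1 = cumulantSeries k := by
    have h1 : lowerOp 1 = 0 := by ext n; simp [lowerOp, coeff_one]
    have h2 : oddLowerOp 1 = 0 := by ext n; simp [oddLowerOp, coeff_one]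
    simp [qgOperator, h1, h2]
  rw [qgCumulantToMoment, deformedMoment]
  -- As `g` is the operator applied to `1`, the number of applications becomes even and they can be
  -- paired.
  have h3 : (qgOperator q γ (cumulantSeries k))^[2 * (j : ℕ) - 1] (cumulantSeries k) =
      (qgOperator q γ (cumulantSeries k))^[2 * (j : ℕ)] 1 := by
    have := j.pos
    conv_rhs => rw [show 2 * (j : ℕ) = 2 * (j : ℕ) - 1 + 1 by omega, Function.iterate_succ_apply, h0]
  rw [h3, cumulantSeries_eq_oddExpand hs hk]
  set G := cumulantEgfDeriv (rescaledCumulant q γ k)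
  have key : ∀ n : ℕ, ((qgOperator q γ (oddExpand (q * γ) G))^[2])^[n] 1 = evenExpand (q * γ)
      ((fun f => evenStep (1 / (q * γ)) G (oddStep γ G f))^[n] 1) := by
    intro n
    induction n with
    | zero => simp
    | succ n ih =>
      rw [Function.iterate_succ_apply', ih, Function.iterate_succ_apply, Function.iterate_one,
        qgOperator_evenExpand, qgOperator_oddExpand hs, Function.iterate_succ_apply']
  rw [Function.iterate_mul, key, constantCoeff_evenExpand]

/-! ### Bijectivity of the cumulant maps -/

lemma rescaledCumulant_bijOn {q γ : ℝ} (hs : q * γ ≠ 0) :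
    Set.BijOn (rescaledCumulant q γ) oddVanishing Set.univ := by
  have hne : ∀ l : ℕ+, (q * γ) ^ (l : ℕ) * 2 ^ (2 * (l : ℕ) - 1) *
      (Nat.factorial ((l : ℕ) - 1) : ℝ) ≠ 0 := fun l => by positivity
  refine ⟨fun _ _ => Set.mem_univ _, fun k hk k' hk' h => ?_, fun κ _ => ?_⟩
  · funext l
    rcases Nat.even_or_odd' (l : ℕ) with ⟨i, hi | hi⟩
    · have hi0 : 0 < i := by have := l.pos; omega
      have hl : l = 2 * ⟨i, hi0⟩ := PNat.eq hi
      rw [hl]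
      exact mul_left_cancel₀ (hne _) (congrFun h ⟨i, hi0⟩)
    · rw [hk l ⟨i, hi⟩, hk' l ⟨i, hi⟩]
  -- For even `l` the index `l / 2` is positive, so the default value of `toPNat'` is never used.
  · refine ⟨fun l => if Odd (l : ℕ) then 0 else
      κ ((l : ℕ) / 2).toPNat' / ((q * γ) ^ ((l : ℕ) / 2) * 2 ^ (2 * ((l : ℕ) / 2) - 1) *
      (Nat.factorial ((l : ℕ) / 2 - 1) : ℝ)), fun l hl => if_pos hl, ?_⟩
    funext l
    have h1 : ((2 * l : ℕ+) : ℕ) / 2 = l := by simp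
    have h2 : ¬ Odd ((2 * l : ℕ+) : ℕ) := by simp
    rw [rescaledCumulant, if_neg h2, h1, PNat.coe_toPNat', mul_div_cancel₀ _ (hne l)]

lemma qgCumulantToMoment_bijOn {q γ : ℝ} (hq : 1 ≤ q) (hγ : 0 < γ) :
    Set.BijOn (qgCumulantToMoment q γ) oddVanishing Set.univ := by
  have hs : 0 < q * γ := by positivity
  exact ((Set.bijOn_univ.2 (deformedMoment_bijective hγ.le
    (one_div_pos.2 hs).le)).comp (rescaledCumulant_bijOn hs.ne')).congr fun k hk =>
    (qgCumulantToMoment_eq hs.ne' hk).symm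

lemma qgMomentToCumulant_mem {q γ : ℝ} (hq : 1 ≤ q) (hγ : 0 < γ) (m : ℕ+ → ℝ) :
    qgMomentToCumulant q γ m ∈ oddVanishing :=
  Function.invFunOn_mem ((qgCumulantToMoment_bijOn hq hγ).surjOn (Set.mem_univ m))

lemma qgCumulantToMoment_qgMomentToCumulant {q γ : ℝ} (hq : 1 ≤ q) (hγ : 0 < γ) (m : ℕ+ → ℝ) :
    qgCumulantToMoment q γ (qgMomentToCumulant q γ m) = m :=
  Function.invFunOn_eq ((qgCumulantToMoment_bijOn hq hγ).surjOn (Set.mem_univ m))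

lemma classicalCumulantToMoment_bijective : Function.Bijective classicalCumulantToMoment := by
  have h := deformedMoment_bijective (le_refl 0) (le_refl 0)
  rwa [show deformedMoment 0 0 = classicalCumulantToMoment from funext deformedMoment_zero_zero]
    at h

lemma classicalCumulantToMoment_classicalMomentToCumulant (m : ℕ+ → ℝ) :
    classicalCumulantToMoment (classicalMomentToCumulant m) = m :=
  Function.invFun_eq (classicalCumulantToMoment_bijective.surjective m)

lemma classicalMomentToCumulant_classicalCumulantToMoment (κ : ℕ+ → ℝ) :
    classicalMomentToCumulant (classicalCumulantToMoment κ) = κ :=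
  Function.leftInverse_invFun classicalCumulantToMoment_bijective.injective κ

/-! ### The limit regime -/

lemma tendsto_snd_classicalRegime :
    Tendsto (fun p : ℝ × ℝ => p.2) classicalRegime (𝓝[>] 0) :=
  tendsto_comap.mono_left inf_le_left

lemma tendsto_mul_classicalRegime :
    Tendsto (fun p : ℝ × ℝ => p.1 * p.2) classicalRegime atTop :=
  tendsto_comap.mono_left inf_le_right

lemma tendsto_inv_classicalRegime :
    Tendsto (fun p : ℝ × ℝ => 1 / (p.1 * p.2)) classicalRegime (𝓝 0) := by
  simp only [one_div]
  exact tendsto_inv_atTop_zero.comp tendsto_mul_classicalRegime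

/-- Eventually `0 < γ < 1` and `qγ ≥ 1`, which forces `q ≥ 1`. -/
lemma eventually_classicalRegime : ∀ᶠ p : ℝ × ℝ in classicalRegime, 1 ≤ p.1 ∧ 0 < p.2 := by
  filter_upwards [tendsto_snd_classicalRegime (Ioo_mem_nhdsGT one_pos),
    tendsto_mul_classicalRegime.eventually_ge_atTop 1] with p hp hp'
  refine ⟨?_, hp.1⟩
  by_contra! h
  have : p.2 < 1 := hp.2
  have : 0 < p.2 := hp.1
  nlinarith

/-- The deformed moments of the rescaled cumulants are eventually the constant `m`, so convergence
of the inverse applies. -/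
lemma tendsto_rescaledCumulant (m : ℕ+ → ℝ) :
    Tendsto (fun p : ℝ × ℝ => rescaledCumulant p.1 p.2 (qgMomentToCumulant p.1 p.2 m))
      classicalRegime (𝓝 (classicalMomentToCumulant m)) := by
  refine tendsto_of_tendsto_deformedMoment le_rfl le_rfl
    (tendsto_nhds_of_tendsto_nhdsWithin tendsto_snd_classicalRegime) tendsto_inv_classicalRegime ?_
  rw [deformedMoment_zero_zero, classicalCumulantToMoment_classicalMomentToCumulant]
  refine tendsto_const_nhds.congr' ?_
  filter_upwards [eventually_classicalRegime] with p ⟨hq, hγ⟩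
  have hs : 0 < p.1 * p.2 := by positivity
  rw [← qgCumulantToMoment_eq hs.ne' (qgMomentToCumulant_mem hq hγ m),
    qgCumulantToMoment_qgMomentToCumulant hq hγ]

lemma rescaledCumulant_add (q γ : ℝ) (k k' : ℕ+ → ℝ) :
    rescaledCumulant q γ (k + k') = rescaledCumulant q γ k + rescaledCumulant q γ k' := by
  funext l
  simp [rescaledCumulant, mul_add]

lemma tendsto_qgConvolution (a b : ℕ+ → ℝ) :
    Tendsto (fun p : ℝ × ℝ => qgConvolution p.1 p.2 a b) classicalRegime
      (𝓝 (classicalCumulantToMoment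
        (classicalMomentToCumulant a + classicalMomentToCumulant b))) := by
  rw [← deformedMoment_zero_zero]
  refine (tendsto_deformedMoment (tendsto_nhds_of_tendsto_nhdsWithin tendsto_snd_classicalRegime)
    tendsto_inv_classicalRegime
    ((tendsto_rescaledCumulant a).add (tendsto_rescaledCumulant b))).congr' ?_
  filter_upwards [eventually_classicalRegime] with p ⟨hq, hγ⟩
  have hs : 0 < p.1 * p.2 := by positivity
  rw [qgConvolution, qgCumulantToMoment_eq hs.ne', rescaledCumulant_add]
  intro l hl
  rw [Pi.add_apply, qgMomentToCumulant_mem hq hγ a l hl, qgMomentToCumulant_mem hq hγ b l hl,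
    add_zero]

/-! ### Moments of the convolution of measures -/

section Measure

open MeasureTheory

lemma integrable_choose_mul_pow_prod {μ ν : Measure ℝ} [SFinite ν]
    (hμ : ∀ k : ℕ, Integrable (fun x : ℝ => x ^ k) μ)
    (hν : ∀ k : ℕ, Integrable (fun x : ℝ => x ^ k) ν) (k i : ℕ) :
    Integrable (fun z : ℝ × ℝ => (k.choose i : ℝ) * (z.1 ^ i * z.2 ^ (k - i))) (μ.prod ν) :=
  ((hμ i).mul_prod (hν (k - i))).const_mul _

lemma add_pow_eq_sum_choose (k : ℕ) : (fun z : ℝ × ℝ => (z.1 + z.2) ^ k) =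
    fun z => ∑ i ∈ range (k + 1), (k.choose i : ℝ) * (z.1 ^ i * z.2 ^ (k - i)) := by
  funext z
  rw [add_pow]
  exact sum_congr rfl fun i _ => by ring

lemma integrable_pow_conv {μ ν : Measure ℝ} [SFinite ν]
    (hμ : ∀ k : ℕ, Integrable (fun x : ℝ => x ^ k) μ)
    (hν : ∀ k : ℕ, Integrable (fun x : ℝ => x ^ k) ν) (k : ℕ) :
    Integrable (fun x : ℝ => x ^ k) (Measure.conv μ ν) := by
  rw [Measure.conv, integrable_map_measure (by fun_prop) (by fun_prop)]
  refine Integrable.congr (integrable_finsetSum (range (k + 1)) fun i _ =>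
    integrable_choose_mul_pow_prod hμ hν k i) (Eventually.of_forall fun z => ?_)
  exact (congrFun (add_pow_eq_sum_choose k) z).symm

lemma integral_pow_conv {μ ν : Measure ℝ} [SFinite μ] [SFinite ν]
    (hμ : ∀ k : ℕ, Integrable (fun x : ℝ => x ^ k) μ)
    (hν : ∀ k : ℕ, Integrable (fun x : ℝ => x ^ k) ν) (k : ℕ) :
    ∫ x, x ^ k ∂(Measure.conv μ ν) =
      ∑ i ∈ range (k + 1), (k.choose i : ℝ) * ((∫ x, x ^ i ∂μ) * ∫ x, x ^ (k - i) ∂ν) := by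
  rw [Measure.conv, integral_map (by fun_prop) (by fun_prop), add_pow_eq_sum_choose,
    integral_finsetSum _ fun i _ => integrable_choose_mul_pow_prod hμ hν k i]
  refine sum_congr rfl fun i _ => ?_
  rw [integral_const_mul, integral_prod_mul (fun x : ℝ => x ^ i) (fun x : ℝ => x ^ (k - i))]

lemma momentSeq_eq_integral_pow {μ : Measure ℝ} [IsProbabilityMeasure μ] {κ : ℕ+ → ℝ}
    (h : ∀ k : ℕ+, classicalCumulantToMoment κ k = ∫ x, x ^ (k : ℕ) ∂μ) (i : ℕ) :
    momentSeq κ i = ∫ x, x ^ i ∂μ := by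
  rcases i with _ | i
  · simp [momentSeq_zero]
  · exact h i.succPNat

lemma integrable_pow_of_pnat {μ : Measure ℝ} [IsFiniteMeasure μ]
    (h : ∀ k : ℕ+, Integrable (fun x : ℝ => x ^ (k : ℕ)) μ) (k : ℕ) :
    Integrable (fun x : ℝ => x ^ k) μ := by
  rcases k with _ | k
  · simp
  · exact h k.succPNat

/-- Both sides are the same binomial sum of products of moments; total mass `1` accounts for the
moments of order `0`. -/
lemma classicalCumulantToMoment_add_eq_integral_conv {μ ν : Measure ℝ}
    [IsProbabilityMeasure μ] [IsProbabilityMeasure ν] {κ κ' : ℕ+ → ℝ}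
    (hμ : ∀ k : ℕ, Integrable (fun x : ℝ => x ^ k) μ)
    (hν : ∀ k : ℕ, Integrable (fun x : ℝ => x ^ k) ν)
    (h : ∀ k : ℕ+, classicalCumulantToMoment κ k = ∫ x, x ^ (k : ℕ) ∂μ)
    (h' : ∀ k : ℕ+, classicalCumulantToMoment κ' k = ∫ x, x ^ (k : ℕ) ∂ν) (k : ℕ+) :
    classicalCumulantToMoment (κ + κ') k = ∫ x, x ^ (k : ℕ) ∂(Measure.conv μ ν) := by
  rw [classicalCumulantToMoment_add, integral_pow_conv hμ hν]
  exact sum_congr rfl fun i _ => by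
    rw [momentSeq_eq_integral_pow h, momentSeq_eq_integral_pow h']

end Measure

end CumulantLimit

theorem theorem5p8 :
    -- the cumulants are well defined
    (∀ q γ : ℝ, 1 ≤ q → 0 < γ →
      Set.BijOn (qgCumulantToMoment q γ) oddVanishing Set.univ) ∧
    Function.Bijective classicalCumulantToMoment ∧
    -- the rescaled q-γ cumulants tend to the classical cumulants
    (∀ m : ℕ+ → ℝ,
      Tendsto (fun p : ℝ × ℝ => rescaledCumulant p.1 p.2 (qgMomentToCumulant p.1 p.2 m))
        classicalRegime (𝓝 (classicalMomentToCumulant m))) ∧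
    -- the q-γ convolution degenerates to the usual convolution
    (∀ a b : ℕ+ → ℝ, ∃ c : ℕ+ → ℝ,
      Tendsto (fun p : ℝ × ℝ => qgConvolution p.1 p.2 a b) classicalRegime (𝓝 c) ∧
      classicalMomentToCumulant c =
        classicalMomentToCumulant a + classicalMomentToCumulant b ∧
      ∀ μ ν : MeasureTheory.Measure ℝ,
        MeasureTheory.IsProbabilityMeasure μ → MeasureTheory.IsProbabilityMeasure ν →
        μ (Set.Iio 0) = 0 → ν (Set.Iio 0) = 0 →
        (∀ k : ℕ+, MeasureTheory.Integrable (fun x : ℝ => x ^ (k : ℕ)) μ ∧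
          a k = ∫ x, x ^ (k : ℕ) ∂μ) →
        (∀ k : ℕ+, MeasureTheory.Integrable (fun x : ℝ => x ^ (k : ℕ)) ν ∧
          b k = ∫ x, x ^ (k : ℕ) ∂ν) →
        ∀ k : ℕ+,
          MeasureTheory.Integrable (fun x : ℝ => x ^ (k : ℕ)) (MeasureTheory.Measure.conv μ ν) ∧
          c k = ∫ x, x ^ (k : ℕ) ∂(MeasureTheory.Measure.conv μ ν)) := by
  refine ⟨fun q γ => qgCumulantToMoment_bijOn, classicalCumulantToMoment_bijective,
    tendsto_rescaledCumulant, fun a b => ⟨_, tendsto_qgConvolution a b,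
    classicalMomentToCumulant_classicalCumulantToMoment _, ?_⟩⟩
  intro μ ν _ _ _ _ ha hb k
  have hμ := integrable_pow_of_pnat fun k => (ha k).1
  have hν := integrable_pow_of_pnat fun k => (hb k).1
  refine ⟨integrable_pow_conv hμ hν k, classicalCumulantToMoment_add_eq_integral_conv hμ hν
    (fun i => ?_) (fun i => ?_) k⟩
  · rw [classicalCumulantToMoment_classicalMomentToCumulant, (ha i).2]
  · rw [classicalCumulantToMoment_classicalMomentToCumulant, (hb i).2]
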